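/- Let $\mathbb{T}^1=\mathbb{R}/\mathbb{Z}$ and $\mathbb{I}=[0,1]$. A quasiperiodically forced interval map is a continuous map $F:\mathbb{T}^1\times\mathbb{I}\to\mathbb{T}^1\times\mathbb{I}$ of the form $F(\theta,x)=(\theta+\omega,F_\theta(x))$ with $\omega$ irrational. A continuous curve is a set $\Gamma=\{(\theta,\gamma(\theta)) : \theta\in\mathbb{T}^1\}$ with $\gamma:\mathbb{T}^1\to\mathbb{I}$ continuous; it is invariant under $F$ if $F(\Gamma)=\Gamma$, and $n$-periodic ($n\ge 1$) if $F^n(\Gamma)=\Gamma$ and $F^m(\Gamma)\neq\Gamma$ for $1\le m<n$. **Proposition.** There exists a quasiperiodically forced interval map which has a three-periodic continuous curve, but no invariant continuous curve. Consequently, the analogue of Sharkovsky's theorem in which periodic points are replaced by periodic continuous curves is false. That is, with the Sharkovsky ordering $$1 \triangleleft 2 \triangleleft 2^2 \triangleleft \dots \triangleleft 2^2\cdot 7 \triangleleft 2^2\cdot 5 \triangleleft 2^2\cdot 3 \triangleleft \dots \triangleleft 2\cdot 7 \triangleleft 2\cdot 5 \triangleleft 2\cdot 3 \triangleleft \dots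 \triangleleft 7 \triangleleft 5 \triangleleft 3$$ of the positive integers, it is not true that every quasiperiodically forced interval map with an $n$-periodic continuous curve has an $m$-periodic continuous curve for every $m\triangleleft n$. -/

import Mathlib

/-- The annulus `𝕋¹ × [0,1]`, with `𝕋¹ = ℝ/ℤ`. -/
abbrev Annulus : Type := UnitAddCircle × unitInterval

/-- `F` is a quasiperiodically forced interval map: a continuous skew product
`F (θ, x) = (θ + ω, F_θ x)` over the rotation of the circle by some irrational `ω`. -/
def IsQPForcedIntervalMap (F : Annulus → Annulus) : Prop :=
  Continuous F ∧ ∃ ω : ℝ, Irrational ω ∧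
    ∀ (θ : UnitAddCircle) (x : unitInterval), (F (θ, x)).1 = θ + (ω : UnitAddCircle)

/-- `Γ` is a continuous curve: the graph of a continuous function `γ : 𝕋¹ → [0,1]`. -/
def IsContinuousCurve (Γ : Set Annulus) : Prop :=
  ∃ γ : UnitAddCircle → unitInterval, Continuous γ ∧ Γ = {p | p.2 = γ p.1}

/-- `Γ` is an `F`-invariant continuous curve. -/
def IsInvariantCurve (F : Annulus → Annulus) (Γ : Set Annulus) : Prop :=
  IsContinuousCurve Γ ∧ F '' Γ = Γ

/-- `Γ` is an `n`-periodic continuous curve of `F`, where `n` is the least period. -/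
def IsPeriodicCurve (F : Annulus → Annulus) (n : ℕ) (Γ : Set Annulus) : Prop :=
  IsContinuousCurve Γ ∧ 0 < n ∧ F^[n] '' Γ = Γ ∧
    ∀ m : ℕ, 0 < m → m < n → F^[m] '' Γ ≠ Γ

/-- The strict Sharkovsky ordering of the positive integers
`1 ◁ 2 ◁ 2² ◁ … ◁ 2²·7 ◁ 2²·5 ◁ 2²·3 ◁ … ◁ 2·7 ◁ 2·5 ◁ 2·3 ◁ … ◁ 7 ◁ 5 ◁ 3`. -/
def SharkovskyLT (m n : ℕ) : Prop :=
  (∃ a b : ℕ, m = 2 ^ a ∧ n = 2 ^ b ∧ a < b) ∨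
  (∃ a b q : ℕ, Odd q ∧ 1 < q ∧ m = 2 ^ a ∧ n = 2 ^ b * q) ∨
  (∃ a b p q : ℕ, Odd p ∧ 1 < p ∧ Odd q ∧ 1 < q ∧ m = 2 ^ a * p ∧ n = 2 ^ b * q ∧
    (b < a ∨ (a = b ∧ q < p)))

/-! The circles at heights `0`, `1/2`, `1` are permuted cyclically. By minimality of the rotation by
`3 * ω`, an invariant curve touching one of them would coincide with it, which is absurd
(`ne_of_cycle`). Points at or below `1/2` map to `1/2` or above, so by the intermediate value
theorem an invariant curve lies strictly between `1/2` and `1`. The fibre maps are folded so that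
this strip contains no such curve (`not_fiberFun_mem`). At one end of the parameter path the curve
must be below `2/3`, at the other above `5/6`. On the first half of the path `2/3` is sent to `1/2`,
on the second half `5/6` is sent to `1`, so each height is a barrier in turn and the curve cannot
get across. -/

/-- A closed subset of the circle which is forward invariant under an irrational rotation and
nonempty is the whole circle. -/
theorem eq_univ_of_isClosed_of_add_mem {ω : ℝ} (hω : Irrational ω) {A : Set UnitAddCircle}
    (hA : IsClosed A) {θ₀ : UnitAddCircle} (h₀ : θ₀ ∈ A)
    (h : ∀ θ ∈ A, θ + (ω : UnitAddCircle) ∈ A) : A = Set.univ := by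
  have hd : DenseRange (fun n : ℕ => n • (ω : UnitAddCircle)) := by
    rw [← denseRange_zsmul_iff_nsmul]
    exact AddCircle.denseRange_zsmul_coe_iff.2 (by simpa using hω)
  have hmem : ∀ n : ℕ, θ₀ + n • (ω : UnitAddCircle) ∈ A := by
    intro n
    induction n with
    | zero => simpa using h₀
    | succ n ih => rw [succ_nsmul, ← add_assoc]; exact h _ ih
  have hcl : IsClosed ((fun t => θ₀ + t) ⁻¹' A) := hA.preimage (continuous_const_add θ₀)
  have huniv : ((fun t => θ₀ + t) ⁻¹' A) = Set.univ := by
    rw [← hcl.closure_eq]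
    exact (hd.mono (by rintro _ ⟨n, rfl⟩; exact hmem n)).closure_eq
  refine Set.eq_univ_of_forall fun θ => ?_
  have : θ - θ₀ ∈ ((fun t => θ₀ + t) ⁻¹' A) := huniv ▸ Set.mem_univ _
  simpa using this

/-- A piecewise linear family of interval maps, with parameters `u` and `v` in `[0, 1]`. It sends
`0 ↦ 1/2 ↦ 1 ↦ 0`, and takes the values `(1 + u) / 2` and `(1 + v) / 2` at `2/3` and `5/6`. -/
noncomputable def fiberFun (u v x : ℝ) : ℝ :=
  min (x + 1 / 2) (max (5 / 2 - 3 * x) (min (1 / 2) (3 - 3 * x)))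
    + u * max 0 (1 / 2 - 3 * |x - 2 / 3|) + v * max 0 (1 / 2 - 3 * |x - 5 / 6|)

theorem hat_eq_zero {c x : ℝ} (h : 1 / 6 ≤ |x - c|) : max 0 (1 / 2 - 3 * |x - c|) = 0 :=
  max_eq_left (by linarith)

theorem fiberFun_of_le_half (u v : ℝ) {x : ℝ} (h : x ≤ 1 / 2) : fiberFun u v x = x + 1 / 2 := by
  have h₁ : 1 / 6 ≤ |x - 2 / 3| := le_abs.2 (Or.inr (by linarith))
  have h₂ : 1 / 6 ≤ |x - 5 / 6| := le_abs.2 (Or.inr (by linarith))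
  rw [fiberFun, hat_eq_zero h₁, hat_eq_zero h₂,
    min_eq_left (le_max_of_le_left (by linarith : x + 1 / 2 ≤ 5 / 2 - 3 * x))]
  ring

theorem fiberFun_one (u v : ℝ) : fiberFun u v 1 = 0 := by
  norm_num [fiberFun, abs_of_pos]

theorem fiberFun_two_thirds (u v : ℝ) : fiberFun u v (2 / 3) = (1 + u) / 2 := by
  norm_num [fiberFun, abs_of_neg]; ring

theorem fiberFun_five_sixths (u v : ℝ) : fiberFun u v (5 / 6) = (1 + v) / 2 := by
  norm_num [fiberFun, abs_of_pos]; ring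

theorem fiberFun_zero_zero_le {x : ℝ} (h : 2 / 3 ≤ x) : fiberFun 0 0 x ≤ 1 / 2 := by
  simp only [fiberFun, zero_mul, add_zero]
  exact min_le_of_right_le (max_le (by linarith) (min_le_left _ _))

/-- Up to `2/3` the rising side of the first hat cancels the slope `-3`; from `2/3` to `5/6` the two
hats add up to `1/2` over a plateau at `1/2`. -/
theorem le_fiberFun_one_one {x : ℝ} (h : 1 / 2 ≤ x) (h' : x ≤ 5 / 6) :
    1 ≤ fiberFun 1 1 x := by
  have hat₁ := le_max_right 0 (1 / 2 - 3 * |x - 2 / 3|)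
  have hat₂ := le_max_left 0 (1 / 2 - 3 * |x - 5 / 6|)
  have hat₃ := le_max_right 0 (1 / 2 - 3 * |x - 5 / 6|)
  rw [fiberFun, one_mul, one_mul]
  rcases le_total x (2 / 3) with hx | hx
  · have : 5 / 2 - 3 * x ≤ min (x + 1 / 2) (max (5 / 2 - 3 * x) (min (1 / 2) (3 - 3 * x))) :=
      le_min (by linarith) (le_max_left _ _)
    rw [abs_of_nonpos (by linarith : x - 2 / 3 ≤ 0)] at *
    linarith
  · have : 1 / 2 ≤ min (x + 1 / 2) (max (5 / 2 - 3 * x) (min (1 / 2) (3 - 3 * x))) :=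
      le_min (by linarith) (le_max_of_le_right (le_min le_rfl (by linarith)))
    rw [abs_of_nonneg (by linarith : 0 ≤ x - 2 / 3)] at *
    rw [abs_of_nonpos (by linarith : x - 5 / 6 ≤ 0)] at *
    linarith

/-- The forced interval map over the rotation by `√2` with fibre maps `fiberFun u v`, where
`(u, v)` runs from `(0, 0)` through `(0, 1)` to `(1, 1)` as the distance of `θ` to `0` grows. -/
noncomputable def foldedMap (p : Annulus) : Annulus :=
  (p.1 + ((√2 : ℝ) : UnitAddCircle),
    Set.projIcc 0 1 zero_le_one (fiberFun (max 0 (4 * ‖p.1‖ - 1)) (min 1 (4 * ‖p.1‖)) p.2))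

theorem continuous_foldedMap : Continuous foldedMap := by
  unfold foldedMap fiberFun
  refine (by fun_prop : Continuous fun p : Annulus => p.1 + ((√2 : ℝ) : UnitAddCircle)).prodMk
    (continuous_projIcc.comp ?_)
  fun_prop

theorem isQPForcedIntervalMap_foldedMap : IsQPForcedIntervalMap foldedMap :=
  ⟨continuous_foldedMap, √2, irrational_sqrt_two, fun _ _ => rfl⟩

/-- The point `1/2` of the unit interval. -/
noncomputable def unitHalf : unitInterval := ⟨1 / 2, by norm_num, by norm_num⟩

theorem foldedMap_zero (θ : UnitAddCircle) :
    foldedMap (θ, 0) = (θ + ((√2 : ℝ) : UnitAddCircle), unitHalf) := by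
  refine Prod.ext rfl ?_
  simp only [foldedMap, Set.Icc.coe_zero]
  rw [fiberFun_of_le_half _ _ (by norm_num)]
  exact Subtype.ext (by norm_num [Set.coe_projIcc, unitHalf])

theorem foldedMap_half (θ : UnitAddCircle) :
    foldedMap (θ, unitHalf) = (θ + ((√2 : ℝ) : UnitAddCircle), 1) := by
  refine Prod.ext rfl ?_
  simp only [foldedMap, unitHalf]
  rw [fiberFun_of_le_half _ _ le_rfl]
  exact Subtype.ext (by norm_num [Set.coe_projIcc])

theorem foldedMap_one (θ : UnitAddCircle) :
    foldedMap (θ, 1) = (θ + ((√2 : ℝ) : UnitAddCircle), 0) := by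
  refine Prod.ext rfl ?_
  simp only [foldedMap, Set.Icc.coe_one, fiberFun_one]
  exact Subtype.ext (by norm_num [Set.coe_projIcc])

theorem image_horizontal {F : Annulus → Annulus} {ω : ℝ} {c d : unitInterval}
    (h : ∀ θ, F (θ, c) = (θ + (ω : UnitAddCircle), d)) :
    F '' {p | p.2 = c} = {p | p.2 = d} := by
  ext ⟨θ, x⟩
  constructor
  · rintro ⟨⟨θ', x'⟩, rfl, he⟩
    rw [h] at he
    exact (Prod.ext_iff.1 he).2.symm
  · rintro rfl
    exact ⟨(θ - (ω : UnitAddCircle), c), rfl, by simp [h]⟩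

theorem horizontal_ne {c d : unitInterval} (h : c ≠ d) :
    {p : Annulus | p.2 = c} ≠ {p | p.2 = d} := fun he =>
  h ((Set.ext_iff.1 he (0, c)).1 rfl)

theorem isPeriodicCurve_foldedMap : IsPeriodicCurve foldedMap 3 {p | p.2 = 0} := by
  have h₀ := image_horizontal foldedMap_zero
  have h₁ := image_horizontal foldedMap_half
  have h₂ := image_horizontal foldedMap_one
  have i₁ : foldedMap^[1] '' {p | p.2 = 0} = {p | p.2 = unitHalf} := by
    rw [Function.iterate_one, h₀]
  have i₂ : foldedMap^[2] '' {p | p.2 = 0} = {p | p.2 = 1} := by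
    rw [Function.iterate_succ', Set.image_comp, i₁, h₁]
  refine ⟨⟨fun _ => 0, continuous_const, rfl⟩, by norm_num, ?_, fun m hm hm' => ?_⟩
  · rw [Function.iterate_succ', Set.image_comp, i₂, h₂]
  · obtain rfl | rfl : m = 1 ∨ m = 2 := by omega
    · rw [i₁]
      exact horizontal_ne fun h => by simpa [unitHalf] using congrArg Subtype.val h
    · rw [i₂]
      exact horizontal_ne one_ne_zero

theorem apply_graph_of_image_eq {F : Annulus → Annulus} {ω : ℝ}
    (hF : ∀ p, (F p).1 = p.1 + (ω : UnitAddCircle)) {γ : UnitAddCircle → unitInterval}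
    (h : F '' {p | p.2 = γ p.1} = {p | p.2 = γ p.1}) (θ : UnitAddCircle) :
    F (θ, γ θ) = (θ + (ω : UnitAddCircle), γ (θ + (ω : UnitAddCircle))) := by
  have hm : F (θ, γ θ) ∈ {p : Annulus | p.2 = γ p.1} := h ▸ Set.mem_image_of_mem F rfl
  refine Prod.ext (hF _) ?_
  exact Eq.trans hm (congrArg γ (hF _))

/-- A continuous curve which is invariant under a skew product over an irrational rotation avoids
every horizontal circle of least period three. -/
theorem ne_of_cycle {F : Annulus → Annulus} {ω : ℝ} (hω : Irrational ω)
    {γ : UnitAddCircle → unitInterval} (hγ : Continuous γ)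
    (hinv : ∀ θ, F (θ, γ θ) = (θ + (ω : UnitAddCircle), γ (θ + (ω : UnitAddCircle))))
    {a b c : unitInterval} (hab : a ≠ b)
    (ha : ∀ θ, F (θ, a) = (θ + (ω : UnitAddCircle), b))
    (hb : ∀ θ, F (θ, b) = (θ + (ω : UnitAddCircle), c))
    (hc : ∀ θ, F (θ, c) = (θ + (ω : UnitAddCircle), a)) (θ : UnitAddCircle) : γ θ ≠ a := by
  intro hθ
  have step : ∀ {x y : unitInterval}, (∀ θ, F (θ, x) = (θ + (ω : UnitAddCircle), y)) →
      ∀ θ, γ θ = x → γ (θ + (ω : UnitAddCircle)) = y := by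
    intro x y hxy θ h
    have := hinv θ
    rw [h, hxy] at this
    exact (Prod.ext_iff.1 this).2.symm
  have hu : {θ | γ θ = a} = Set.univ := by
    -- Three steps return the height to `a`, so the contact set is invariant under rotation by `3 *
    -- ω`, still irrational.
    refine eq_univ_of_isClosed_of_add_mem (ω := (3 : ℕ) * ω) (hω.natCast_mul (by norm_num))
      (isClosed_eq hγ continuous_const) hθ fun t ht => ?_
    have e : t + (((3 : ℕ) * ω : ℝ) : UnitAddCircle) =
        t + (ω : UnitAddCircle) + (ω : UnitAddCircle) + (ω : UnitAddCircle) := by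
      rw [← nsmul_eq_mul, AddCircle.coe_nsmul]; abel
    rw [e]
    exact step hc _ (step hb _ (step ha _ ht))
  have hall : ∀ t, γ t = a := fun t => (Set.ext_iff.1 hu t).2 trivial
  exact hab ((hall _).symm.trans (step ha θ (hall θ)))

/-- There is no continuous function on `[0, 1/2]` with values in `(1/2, 1)` which every
fibre map of `foldedMap` sends to `(1/2, 1)`. -/
theorem not_fiberFun_mem {g : ℝ → ℝ} (hg : Continuous g) (h : ∀ t, g t ∈ Set.Ioo (1 / 2) 1)
    (hF : ∀ t ∈ Set.Icc (0 : ℝ) (1 / 2),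
      fiberFun (max 0 (4 * t - 1)) (min 1 (4 * t)) (g t) ∈ Set.Ioo (1 / 2) 1) : False := by
  have h₀ : g 0 < 2 / 3 := by
    by_contra! hc
    have := (hF 0 (by norm_num)).1
    norm_num at this
    have := fiberFun_zero_zero_le hc
    norm_num at this
    linarith
  have h₁ : 5 / 6 < g (1 / 2) := by
    by_contra! hc
    have := (hF (1 / 2) (by norm_num)).2
    norm_num at this
    exact this.not_ge (le_fiberFun_one_one (h _).1.le hc)
  -- For `t ≤ 1/4` the first parameter is `0`, so height `2/3` is sent to `1/2` and cannot be
  -- crossed.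
  have hm : g (1 / 4) < 2 / 3 := by
    by_contra! hc
    obtain ⟨t, ht, hgt⟩ := intermediate_value_Icc (by norm_num : (0 : ℝ) ≤ 1 / 4)
      hg.continuousOn ⟨h₀.le, hc⟩
    have := (hF t ⟨ht.1, by linarith [ht.2]⟩).1
    rw [hgt, fiberFun_two_thirds, max_eq_left (by linarith [ht.2])] at this
    norm_num at this
  -- For `t ≥ 1/4` the second parameter is `1`, so height `5/6` is sent to `1`; yet the graph has to
  -- cross it.
  obtain ⟨t, ht, hgt⟩ := intermediate_value_Icc (by norm_num : (1 / 4 : ℝ) ≤ 1 / 2)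
    hg.continuousOn ⟨(by linarith : g (1 / 4) ≤ 5 / 6), h₁.le⟩
  have := (hF t ⟨by linarith [ht.1], ht.2⟩).2
  rw [hgt, fiberFun_five_sixths, min_eq_left (by linarith [ht.1])] at this
  norm_num at this

theorem not_isInvariantCurve_foldedMap (Γ : Set Annulus) : ¬ IsInvariantCurve foldedMap Γ := by
  rintro ⟨⟨γ, hγ, rfl⟩, him⟩
  have hinv := apply_graph_of_image_eq (fun _ => rfl) him
  have half_ne_one : unitHalf ≠ 1 := fun h => by
    have := congrArg Subtype.val h
    norm_num [unitHalf] at this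
  have hne_half := ne_of_cycle irrational_sqrt_two hγ hinv half_ne_one
    foldedMap_half foldedMap_one foldedMap_zero
  have hne_one := ne_of_cycle irrational_sqrt_two hγ hinv one_ne_zero
    foldedMap_one foldedMap_zero foldedMap_half
  have hval : ∀ θ, (γ (θ + ((√2 : ℝ) : UnitAddCircle)) : ℝ) =
      max 0 (min 1 (fiberFun (max 0 (4 * ‖θ‖ - 1)) (min 1 (4 * ‖θ‖)) (γ θ))) := by
    intro θ
    exact (congrArg Subtype.val (Prod.ext_iff.1 (hinv θ)).2).symm.trans
      (Set.coe_projIcc 0 1 zero_le_one _)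
  have hlt : ∀ θ, (γ θ : ℝ) < 1 := fun θ =>
    lt_of_le_of_ne (γ θ).2.2 fun h => hne_one θ (Subtype.ext h)
  have hgt : ∀ θ, 1 / 2 < (γ θ : ℝ) := by
    by_contra! hc
    obtain ⟨θ, hθ⟩ := hc
    have hle : 1 / 2 ≤ (γ (θ + ((√2 : ℝ) : UnitAddCircle)) : ℝ) := by
      rw [hval, fiberFun_of_le_half _ _ hθ]
      exact le_max_of_le_right (le_min (by norm_num) (by linarith [(γ θ).2.1]))
    obtain ⟨t, ht⟩ := intermediate_value_univ θ _ (continuous_subtype_val.comp hγ) ⟨hθ, hle⟩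
    exact hne_half t (Subtype.ext ht)
  refine not_fiberFun_mem (g := fun t : ℝ => (γ (t : UnitAddCircle) : ℝ))
    (by fun_prop) (fun t => ⟨hgt _, hlt _⟩) fun t ht => ?_
  have hnorm : ‖(t : UnitAddCircle)‖ = t := by
    rw [(AddCircle.norm_coe_eq_abs_iff 1 one_ne_zero).2, abs_of_nonneg ht.1]
    rw [abs_of_nonneg ht.1, abs_one]
    exact ht.2
  have h₁ := hgt ((t : UnitAddCircle) + ((√2 : ℝ) : UnitAddCircle))
  have h₂ := hlt ((t : UnitAddCircle) + ((√2 : ℝ) : UnitAddCircle))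
  rw [hval, hnorm] at h₁ h₂
  -- A clamped value strictly between `1/2` and `1` was not altered by the clamp.
  constructor
  · rcases lt_max_iff.1 h₁ with h | h
    · norm_num at h
    · exact (lt_min_iff.1 h).2
  · rcases min_lt_iff.1 (max_lt_iff.1 h₂).2 with h | h
    · exact absurd h (lt_irrefl _)
    · exact h

theorem mainTheorem5 :
    (∃ F : Annulus → Annulus, IsQPForcedIntervalMap F ∧
      (∃ Γ : Set Annulus, IsPeriodicCurve F 3 Γ) ∧
      ¬ ∃ Γ : Set Annulus, IsInvariantCurve F Γ) ∧
    ¬ (∀ F : Annulus → Annulus, IsQPForcedIntervalMap F →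
        ∀ m n : ℕ, SharkovskyLT m n →
          (∃ Γ : Set Annulus, IsPeriodicCurve F n Γ) →
            ∃ Γ : Set Annulus, IsPeriodicCurve F m Γ) := by
  refine ⟨⟨foldedMap, isQPForcedIntervalMap_foldedMap, ⟨_, isPeriodicCurve_foldedMap⟩,
    fun ⟨Γ, hΓ⟩ => not_isInvariantCurve_foldedMap Γ hΓ⟩, fun h => ?_⟩
  have h13 : SharkovskyLT 1 3 :=
    Or.inr (Or.inl ⟨0, 0, 3, by decide, by norm_num, by norm_num, by norm_num⟩)
  obtain ⟨Γ, hΓ, -, him, -⟩ := h foldedMap isQPForcedIntervalMap_foldedMap 1 3 h13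
    ⟨_, isPeriodicCurve_foldedMap⟩
  exact not_isInvariantCurve_foldedMap Γ ⟨hΓ, by rwa [Function.iterate_one] at him⟩
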